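/- Let $n\ge 0$, $N=2^n$, let $S\subseteq\{0,1\}^n$ be a nonempty set of $M$ marked basis states with Hamming weights $n_1,\dots,n_M$, and suppose that $|S_1\rangle=\frac1{\sqrt M}\sum_{x\in S}|x\rangle$ is symmetric (invariant under all permutations of the $n$ qubits). Let $|\psi_0\rangle=\frac1{\sqrt N}\sum_x|x\rangle$, let $G=(2|\psi_0\rangle\langle\psi_0|-I)O$ with $O$ the operator that flips the sign of the marked basis states, let $|\psi_k\rangle=G^k|\psi_0\rangle$, $\theta=\arcsin\sqrt{M/N}$, $\theta_k=(2k+1)\theta$, let $k_{opt}$ be the integer closest to $(\frac{\pi}{2\theta}-1)/2$ (the larger one in case of a tie), and let $E_k=1-\max_\phi|\langle\psi_k|\phi\rangle|^2$ be the geometric measure of entanglement (GME) of $|\psi_k\rangle$, where $\phi$ ranges over all tensor products of $n$ single-qubit unit vectors. Put $$B(\alpha)=\frac1{\sqrt M}\sum_{i=1}^M\cos^{n-n_i}\tfrac\alpha2\,\sin^{n_i}\tfrac\alpha2,\qquad B_{\max}=\sup_{\alpha\in[0,\pi]}B(\alpha),\qquad \theta_T=\arctan\frac1{B_{\max}},\qquad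 k_T=\frac2\pi\,\theta_T\,k_{opt},$$ so that $\theta_T$ (the turning point) depends only on $n$, $M$ and the Hamming weights $n_i$. (1) For all such $n,S$: the supremum $B_{\max}$ is attained, $0<\theta_T<\pi/2$ and $\cos\theta_T=B_{\max}\sin\theta_T$; the function $t\mapsto\sin^2t$ is strictly increasing on $[0,\theta_T]$ and $t\mapsto 1-B_{\max}^2\sin^2t$ is strictly decreasing on $[\theta_T,\pi/2]$. (2) For every $\varepsilon>0$ there is $\eta>0$ such that for all such $n,S$ with $M\le\eta N$ and for all integers $0\le k,k'\le k_{opt}$: (a) $|E_k-\sin^2\theta_k|\le\varepsilon$ if $\theta_k\le\theta_T$, and $|E_k-(1-B_{\max}^2\sin^2\theta_k)|\le\varepsilon$ if $\theta_k>\theta_T$; (b) the GME is increasing below the turning point: if $k<k'$ and $\theta_{k'}\le\theta_T$, then $E_k<E_{k'}$, provided that $\theta_{k'}-\theta_k\ge\varepsilon$ or $\varepsilon\le\theta_k<\theta_{k'}\le\theta_T-\varepsilon$; (c) the GME is decreasing above it: if $k<k'$ and $\theta_k\ge\theta_T$, then $E_{k'}<E_k$, provided that $\theta_{k'}-\theta_k\ge\varepsilon$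 or $\theta_T+\varepsilon\le\theta_k<\theta_{k'}\le\pi/2-\varepsilon$; (d) if $E_k=\max_{0\le j\le k_{opt}}E_j$, then $|\theta_k-\theta_T|\le\varepsilon$; (e) $|(2k_T+1)\theta-\theta_T|\le\varepsilon$. -/

import Mathlib

open Real Set

namespace Grover

noncomputable section

/-- The Hilbert space of `n` qubits, with computational basis indexed by `{0,1}^n`. -/
abbrev Register (n : ℕ) : Type := EuclideanSpace ℂ (Fin n → Fin 2)

/-- A single qubit. -/
abbrev Qubit : Type := EuclideanSpace ℂ (Fin 2)

/-- The fully separable vector `q₁ ⊗ ⋯ ⊗ qₙ`. -/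
def productState {n : ℕ} (q : Fin n → Qubit) : Register n :=
  WithLp.toLp 2 (fun x => ∏ i, q i (x i))

/-- The squared overlaps of `ψ` with the fully separable pure states
(tensor products of single-qubit unit vectors). -/
def separableOverlaps {n : ℕ} (ψ : Register n) : Set ℝ :=
  {r | ∃ q : Fin n → Qubit, (∀ i, ‖q i‖ = 1) ∧ r = ‖inner ℂ ψ (productState q)‖ ^ 2}

/-- The geometric measure of entanglement `E(ψ) = 1 - max_φ |⟨ψ|φ⟩|²`,
the maximum being over the fully separable pure states. -/
def gme {n : ℕ} (ψ : Register n) : ℝ := 1 - sSup (separableOverlaps ψ)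

/-- The supremum in the definition of `gme` is a maximum. -/
theorem isGreatest_separableOverlaps {n : ℕ} (ψ : Register n) :
    IsGreatest (separableOverlaps ψ) (sSup (separableOverlaps ψ)) := by
  have hset : separableOverlaps ψ =
      (fun q : Fin n → Qubit => ‖inner ℂ ψ (productState q)‖ ^ 2) ''
        (Set.pi Set.univ fun _ => Metric.sphere (0 : Qubit) 1) := by
    ext r
    constructor
    · rintro ⟨q, hq, rfl⟩
      exact ⟨q, fun i _ => by simpa using hq i, rfl⟩
    · rintro ⟨q, hq, rfl⟩
      exact ⟨q, fun i => by simpa using hq i (Set.mem_univ i), rfl⟩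
  have hcont : Continuous
      (fun q : Fin n → Qubit => ‖inner ℂ ψ (productState q)‖ ^ 2) := by
    unfold productState
    fun_prop
  rw [hset]
  refine IsCompact.isGreatest_sSup
    ((isCompact_univ_pi fun _ => isCompact_sphere (0 : Qubit) 1).image hcont) ?_
  refine ⟨_, ⟨fun _ => EuclideanSpace.single 0 1, fun i _ => ?_, rfl⟩⟩
  simp

/-- A state is symmetric if it is invariant under all permutations of the qubits. -/
def IsSymmetricState {n : ℕ} (ψ : Register n) : Prop :=
  ∀ σ : Equiv.Perm (Fin n), ∀ x : Fin n → Fin 2, ψ (x ∘ σ) = ψ x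

/-- The uniform superposition `|S|^{-1/2} ∑_{x ∈ S} |x⟩`. -/
def uniformSuperposition {n : ℕ} (S : Finset (Fin n → Fin 2)) : Register n :=
  WithLp.toLp 2 (fun x => if x ∈ S then (((1 / √(S.card : ℝ)) : ℝ) : ℂ) else 0)

/-- The initial state, `N^{-1/2} ∑_x |x⟩` with `N = 2^n`. -/
def initialState (n : ℕ) : Register n := uniformSuperposition Finset.univ

/-- The oracle: it flips the sign of the marked basis states. -/
def oracle {n : ℕ} (S : Finset (Fin n → Fin 2)) (ψ : Register n) : Register n :=
  WithLp.toLp 2 (fun x => if x ∈ S then -ψ x else ψ x)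

/-- The Grover operation `G = (2|ψ₀⟩⟨ψ₀| - I) O`. -/
def groverOp {n : ℕ} (S : Finset (Fin n → Fin 2)) (ψ : Register n) : Register n :=
  (2 * inner ℂ (initialState n) (oracle S ψ)) • initialState n - oracle S ψ

/-- The state after `k` Grover iterations. -/
def groverState {n : ℕ} (S : Finset (Fin n → Fin 2)) (k : ℕ) : Register n :=
  (groverOp S)^[k] (initialState n)

/-- `θ = arcsin √(M/N)`. -/
def baseAngle {n : ℕ} (S : Finset (Fin n → Fin 2)) : ℝ :=
  arcsin (√((S.card : ℝ) / 2 ^ n))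

/-- `θ_k = (2k+1) θ`. -/
def angle {n : ℕ} (S : Finset (Fin n → Fin 2)) (k : ℕ) : ℝ :=
  (2 * (k : ℝ) + 1) * baseAngle S

/-- The optimal number of iterations, the integer closest to `(π/(2θ) - 1)/2`. -/
def kOpt {n : ℕ} (S : Finset (Fin n → Fin 2)) : ℤ :=
  round ((π / (2 * baseAngle S) - 1) / 2)

/-- The multiset `n₁, …, n_M` of Hamming weights of the marked basis states. -/
def weights {n : ℕ} (S : Finset (Fin n → Fin 2)) : Multiset ℕ :=
  S.val.map (fun x => hammingNorm x)

/-- `B(α) = M^{-1/2} ∑ᵢ cos^{n-nᵢ}(α/2) sin^{nᵢ}(α/2)`, for a multiset `w` of `M` weights `nᵢ ≤ n`. -/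
def B (n : ℕ) (w : Multiset ℕ) (α : ℝ) : ℝ :=
  1 / √(w.card : ℝ) * (w.map fun m => cos (α / 2) ^ (n - m) * sin (α / 2) ^ m).sum

/-- `B_max = max_{α ∈ [0,π]} B(α)`. -/
def Bmax (n : ℕ) (w : Multiset ℕ) : ℝ := sSup (B n w '' Icc 0 π)

/-- The turning point `arctan (1 / B_max)`. It is a function of `n` and of the multiset of Hamming
weights, whose cardinality is `M`. -/
def turningPoint (n : ℕ) (w : Multiset ℕ) : ℝ := arctan (1 / Bmax n w)

/-- The (real-valued) turning iteration `k_T = (2/π) θ_T k_opt`. -/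
def turningIteration {n : ℕ} (S : Finset (Fin n → Fin 2)) : ℝ :=
  2 / π * turningPoint n (weights S) * (kOpt S : ℝ)

end

end Grover

/-! Let |S₀⟩ and |S₁⟩ be the uniform superpositions over the unmarked and the marked basis states.
Each Grover step rotates their plane by 2θ, so |ψ_k⟩ = cos θ_k |S₀⟩ + sin θ_k |S₁⟩
(`groverState_eq_planeState`). Up to π/2, phases do not help a product state, so 1 - E_k is the
maximum of (p cos θ_k + q sin θ_k)² over the planar set of pairs (p, q) of overlaps with |S₀⟩ and
|S₁⟩ of product states with nonnegative amplitudes.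

The crux is a dimension-free uncertainty principle, `overlap_uncertainty`: for M/N small, p or q is
at most δ. The value p = 1 is almost reached by |ψ₀⟩, itself a product state. The largest q is
B_max, because averaging angles shows that identical qubits are optimal for a symmetric S
(`exists_const_sum_productAmp_le`). So 1 - E_k is close to max(cos² θ_k, B_max² sin² θ_k), uniformly
in n and S, and the two branches cross at θ_T. This yields the branch estimates, the comparison of
well separated angles and the location of the maximum.

For neighbouring angles the error may exceed the difference of the branch values. There one product
state is tested at both angles: below θ_T the optimal one at the larger angle lies mainly along
|S₀⟩, so its overlap grows when the state is rotated back; above θ_T the roles are exchanged. -/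

namespace Grover
noncomputable section

/-! ### Uncertainty principle for real product states -/

/-- The amplitudes `cos a`, `sin a` of a real qubit. -/
def qubitAmp (a : ℝ) (j : Fin 2) : ℝ := if j = 0 then cos a else sin a

/-- The amplitudes of the product of the real qubits with angles `a i`. -/
def productAmp {n : ℕ} (a : Fin n → ℝ) (x : Fin n → Fin 2) : ℝ := ∏ i, qubitAmp (a i) (x i)

/-- The overlap of a real product state with the uniform superposition over `T`. -/
def overlap {n : ℕ} (T : Finset (Fin n → Fin 2)) (a : Fin n → ℝ) : ℝ :=
  (∑ x ∈ T, productAmp a x) / √(T.card : ℝ)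

theorem qubitAmp_nonneg {a : ℝ} (ha : a ∈ Icc 0 (π / 2)) (j : Fin 2) : 0 ≤ qubitAmp a j := by
  have h := pi_pos
  unfold qubitAmp
  split_ifs
  · exact cos_nonneg_of_mem_Icc ⟨by linarith [ha.1], ha.2⟩
  · exact sin_nonneg_of_nonneg_of_le_pi ha.1 (by linarith [ha.2])

theorem productAmp_nonneg {n : ℕ} {a : Fin n → ℝ} (ha : ∀ i, a i ∈ Icc 0 (π / 2))
    (x : Fin n → Fin 2) : 0 ≤ productAmp a x :=
  Finset.prod_nonneg fun i _ => qubitAmp_nonneg (ha i) _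

theorem overlap_nonneg {n : ℕ} (T : Finset (Fin n → Fin 2)) {a : Fin n → ℝ}
    (ha : ∀ i, a i ∈ Icc 0 (π / 2)) : 0 ≤ overlap T a :=
  div_nonneg (Finset.sum_nonneg fun x _ => productAmp_nonneg ha x) (sqrt_nonneg _)

theorem sum_prod_qubits {n : ℕ} (h : Fin n → Fin 2 → ℝ) :
    ∑ x : Fin n → Fin 2, ∏ i, h i (x i) = ∏ i, (h i 0 + h i 1) := by
  rw [← Fintype.piFinset_univ, ← Finset.prod_univ_sum]
  simp

theorem sum_productAmp_pow {n : ℕ} (a : Fin n → ℝ) (m : ℕ) :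
    ∑ x, productAmp a x ^ m = ∏ i, (cos (a i) ^ m + sin (a i) ^ m) := by
  simp only [productAmp, ← Finset.prod_pow]
  rw [sum_prod_qubits fun i j => qubitAmp (a i) j ^ m]
  simp [qubitAmp]

theorem sum_productAmp_sq {n : ℕ} (a : Fin n → ℝ) : ∑ x, productAmp a x ^ 2 = 1 := by
  simp [sum_productAmp_pow]

theorem sqrt_card_mul_overlap {n : ℕ} (T : Finset (Fin n → Fin 2)) (a : Fin n → ℝ) :
    √(T.card : ℝ) * overlap T a = ∑ x ∈ T, productAmp a x := by
  rcases T.eq_empty_or_nonempty with rfl | hT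
  · simp [overlap]
  · have : 0 < √(T.card : ℝ) := sqrt_pos.2 (by exact_mod_cast hT.card_pos)
    unfold overlap
    field_simp

theorem overlap_le_one {n : ℕ} (T : Finset (Fin n → Fin 2)) (a : Fin n → ℝ) :
    overlap T a ≤ 1 := by
  have h1 : (∑ x ∈ T, productAmp a x) ^ 2 ≤ T.card * ∑ x ∈ T, productAmp a x ^ 2 :=
    sq_sum_le_card_mul_sum_sq
  have h2 : ∑ x ∈ T, productAmp a x ^ 2 ≤ 1 := by
    rw [← sum_productAmp_sq a]
    exact Finset.sum_le_sum_of_subset_of_nonneg (Finset.subset_univ _) fun _ _ _ => sq_nonneg _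
  refine div_le_one_of_le₀ (le_sqrt_of_sq_le ?_) (sqrt_nonneg _)
  nlinarith [Nat.cast_nonneg (α := ℝ) T.card]

/-- The power mean inequality passes to fourth powers; their sum, extended to all basis states,
factorizes over the qubits. -/
theorem overlap_pow_four_le {n : ℕ} (T : Finset (Fin n → Fin 2)) {a : Fin n → ℝ}
    (ha : ∀ i, a i ∈ Icc 0 (π / 2)) :
    overlap T a ^ 4 ≤ T.card * ∏ i, (cos (a i) ^ 4 + sin (a i) ^ 4) := by
  rcases T.eq_empty_or_nonempty with rfl | hT
  · simp [overlap]
  have hM : 0 < (T.card : ℝ) := by exact_mod_cast hT.card_pos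
  have h1 : (∑ x ∈ T, productAmp a x) ^ 4 / (T.card : ℝ) ^ 3 ≤ ∑ x ∈ T, productAmp a x ^ 4 :=
    pow_sum_div_card_le_sum_pow (fun x _ => productAmp_nonneg ha x) 3
  have h2 : ∑ x ∈ T, productAmp a x ^ 4 ≤ ∏ i, (cos (a i) ^ 4 + sin (a i) ^ 4) := by
    rw [← sum_productAmp_pow]
    exact Finset.sum_le_sum_of_subset_of_nonneg (Finset.subset_univ _) fun _ _ _ => by positivity
  have h3 : √(T.card : ℝ) ^ 4 = (T.card : ℝ) ^ 2 := by
    rw [show 4 = 2 * 2 from rfl, pow_mul, sq_sqrt hM.le]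
  have h4 := h1.trans h2
  rw [overlap, div_pow, h3]
  rw [div_le_iff₀ (by positivity)] at h4 ⊢
  nlinarith

theorem overlap_univ {n : ℕ} (a : Fin n → ℝ) :
    overlap Finset.univ a = ∏ i, ((cos (a i) + sin (a i)) / √2) := by
  have h := sum_productAmp_pow a 1
  simp only [pow_one] at h
  rw [overlap, h, Finset.prod_div_distrib]
  congr 1
  simp [sqrt_eq_rpow, ← rpow_natCast, ← rpow_mul, mul_comm]

/-- With u = sin 2a the left side is ((1+u)/2)⁴(1 - u²/2), equal to 1/2 at u = 1. Against fourth
powers the exponent 8 is the least possible: the derivative at u = 1 vanishes, and for a smaller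
exponent it would be negative. -/
theorem qubit_uncertainty {a : ℝ} (ha : a ∈ Icc 0 (π / 2)) :
    ((cos a + sin a) / √2) ^ 8 * (cos a ^ 4 + sin a ^ 4) ≤ 1 / 2 := by
  have hc := qubitAmp_nonneg ha 0
  have hs := qubitAmp_nonneg ha 1
  simp only [qubitAmp, if_true, one_ne_zero, if_false] at hc hs
  have h1 := sin_sq_add_cos_sq a
  set u := 2 * (sin a * cos a) with hu
  have h0 : 0 ≤ u := by positivity
  have hle : u ≤ 1 := by nlinarith [sq_nonneg (sin a - cos a)]
  have e1 : ((cos a + sin a) / √2) ^ 8 = ((1 + u) / 2) ^ 4 := by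
    rw [show 8 = 2 * 4 from rfl, pow_mul, div_pow, sq_sqrt (by norm_num)]
    congr 2
    nlinarith
  have e2 : cos a ^ 4 + sin a ^ 4 = 1 - u ^ 2 / 2 := by
    have : (sin a ^ 2 + cos a ^ 2) ^ 2 = 1 := by rw [h1]; norm_num
    rw [hu]; nlinarith
  rw [e1, e2]
  have hv : 0 ≤ 1 - u := by linarith
  -- With v = 1 - u the left side is 1 - v²(3 - v)/4. Squaring suffices, since 2 - u² ≤ (2 - u)².
  have key : ((1 + u) / 2) ^ 2 * (1 + (1 - u)) ≤ 1 := by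
    nlinarith [mul_nonneg h0 hv, mul_nonneg hv hv, mul_nonneg h0 (mul_nonneg hv hv)]
  have k0 : 0 ≤ ((1 + u) / 2) ^ 2 * (1 + (1 - u)) := by positivity
  have key2 : (((1 + u) / 2) ^ 2 * (1 + (1 - u))) ^ 2 ≤ 1 := pow_le_one₀ k0 key
  have : 2 - u ^ 2 ≤ (1 + (1 - u)) ^ 2 := by nlinarith
  have : ((1 + u) / 2) ^ 4 * (2 - u ^ 2) ≤ ((1 + u) / 2) ^ 4 * (1 + (1 - u)) ^ 2 :=
    mul_le_mul_of_nonneg_left this (by positivity)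
  nlinarith

/-- A product state cannot overlap much with both the uniform superposition over all basis states
and that over a sparse set of them. -/
theorem overlap_uncertainty {n : ℕ} (T : Finset (Fin n → Fin 2)) {a : Fin n → ℝ}
    (ha : ∀ i, a i ∈ Icc 0 (π / 2)) :
    overlap Finset.univ a ^ 8 * overlap T a ^ 4 ≤ T.card / 2 ^ n := by
  have h0 : 0 ≤ overlap Finset.univ a ^ 8 := by positivity
  have h1 : overlap Finset.univ a ^ 8 * ∏ i, (cos (a i) ^ 4 + sin (a i) ^ 4) ≤ 1 / 2 ^ n := by
    rw [overlap_univ, ← Finset.prod_pow, ← Finset.prod_mul_distrib]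
    calc _ ≤ ∏ _i : Fin n, (1 / 2 : ℝ) :=
          Finset.prod_le_prod (fun _ _ => by positivity) fun i _ => qubit_uncertainty (ha i)
      _ = _ := by simp
  calc _ ≤ overlap Finset.univ a ^ 8 * (T.card * ∏ i, (cos (a i) ^ 4 + sin (a i) ^ 4)) :=
        mul_le_mul_of_nonneg_left (overlap_pow_four_le T ha) h0
    _ = T.card * (overlap Finset.univ a ^ 8 * ∏ i, (cos (a i) ^ 4 + sin (a i) ^ 4)) := by ring
    _ ≤ T.card * (1 / 2 ^ n) := mul_le_mul_of_nonneg_left h1 (Nat.cast_nonneg _)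
    _ = _ := by ring

/-- At least a quarter of the basis states is unmarked, so the two normalizations differ by a factor
of at most 2. -/
theorem overlap_compl_le {n : ℕ} (S : Finset (Fin n → Fin 2)) {a : Fin n → ℝ}
    (ha : ∀ i, a i ∈ Icc 0 (π / 2)) (hS : (S.card : ℝ) ≤ 3 / 4 * 2 ^ n) :
    overlap Sᶜ a ≤ 2 * overlap Finset.univ a := by
  have hc : (Sᶜ.card : ℝ) = 2 ^ n - S.card := by
    rw [Finset.card_compl, Nat.cast_sub (Finset.card_le_univ _)]; simp
  have h1 := sqrt_card_mul_overlap Sᶜ a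
  have h2 := sqrt_card_mul_overlap Finset.univ a
  have h3 : ∑ x ∈ Sᶜ, productAmp a x ≤ ∑ x, productAmp a x :=
    Finset.sum_le_sum_of_subset_of_nonneg (Finset.subset_univ _)
      fun x _ _ => productAmp_nonneg ha x
  have h4 : √((Finset.univ : Finset (Fin n → Fin 2)).card : ℝ) ≤ 2 * √(Sᶜ.card : ℝ) := by
    apply sqrt_le_left (by positivity) |>.2
    rw [mul_pow, sq_sqrt (Nat.cast_nonneg _), hc]
    simp
    linarith
  have h5 : 0 < √((Finset.univ : Finset (Fin n → Fin 2)).card : ℝ) := by simp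
  have h6 := overlap_nonneg Sᶜ ha
  have h7 := overlap_nonneg Finset.univ ha
  have h8 := mul_le_mul_of_nonneg_right h4 h6
  refine le_of_mul_le_mul_left ?_ h5
  linarith

theorem overlap_compl_le_or_overlap_le {n : ℕ} (S : Finset (Fin n → Fin 2)) {a : Fin n → ℝ}
    (ha : ∀ i, a i ∈ Icc 0 (π / 2)) {δ : ℝ} (hδ : 0 < δ) (hδ' : δ ≤ 1)
    (hS : (S.card : ℝ) ≤ δ ^ 12 / 512 * 2 ^ n) :
    overlap Sᶜ a ≤ δ ∨ overlap S a ≤ δ := by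
  by_contra! h
  have hp : (0 : ℝ) < 2 ^ n := by positivity
  have h1 : δ ^ 12 ≤ 1 := pow_le_one₀ hδ.le hδ'
  have h2 := overlap_compl_le S ha (by nlinarith)
  have h3 := overlap_uncertainty S ha
  rw [le_div_iff₀ hp] at h3
  have h4 : δ / 2 < overlap Finset.univ a := by linarith
  have h5 : (δ / 2) ^ 8 * δ ^ 4 ≤ overlap Finset.univ a ^ 8 * overlap S a ^ 4 := by
    gcongr
    exact h.2.le
  -- If both overlaps exceeded δ, the left side of the uncertainty inequality would be at least
  -- (δ/2)⁸δ⁴ = δ¹²/256, twice what the bound on `S.card` allows.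
  have h6 : δ ^ 12 / 256 * 2 ^ n ≤ δ ^ 12 / 512 * 2 ^ n := by
    calc _ = (δ / 2) ^ 8 * δ ^ 4 * 2 ^ n := by ring
      _ ≤ _ := (mul_le_mul_of_nonneg_right h5 hp.le).trans (h3.trans hS)
  have : 0 < δ ^ 12 * 2 ^ n := by positivity
  linarith

theorem productAmp_const {n : ℕ} (c : ℝ) (x : Fin n → Fin 2) :
    productAmp (fun _ => c) x = cos c ^ (n - hammingNorm x) * sin c ^ hammingNorm x := by
  simp only [productAmp, qubitAmp]
  rw [Finset.prod_ite, Finset.prod_const, Finset.prod_const]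
  have h := Finset.card_filter_add_card_filter_not (s := (Finset.univ : Finset (Fin n)))
    (fun i => x i = 0)
  simp only [Finset.card_univ, Fintype.card_fin] at h
  have h2 : (Finset.univ.filter fun i => ¬ x i = 0).card = hammingNorm x := rfl
  rw [h2] at h ⊢
  congr 2
  omega

theorem overlap_const {n : ℕ} (S : Finset (Fin n → Fin 2)) (α : ℝ) :
    overlap S (fun _ => α / 2) = B n (weights S) α := by
  simp only [overlap, B, weights, productAmp_const, Multiset.card_map, Multiset.map_map]
  rw [div_eq_mul_one_div, mul_comm]
  rfl

theorem overlap_pi_div_four {n : ℕ} (T : Finset (Fin n → Fin 2)) :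
    overlap T (fun _ => π / 4) = √(T.card / 2 ^ n) := by
  have h : ∀ x : Fin n → Fin 2, productAmp (fun _ => π / 4) x = 1 / √(2 ^ n) := by
    intro x
    have : ∀ j, qubitAmp (π / 4) j = (√2)⁻¹ := by
      intro j
      have : √2 / 2 = (√2)⁻¹ := by
        rw [← sqrt_div_self]
      unfold qubitAmp; split_ifs <;> simp [this]
    simp [productAmp, this, sqrt_eq_rpow, ← rpow_natCast, ← rpow_mul, mul_comm]
  rw [overlap, Finset.sum_congr rfl fun x _ => h x, sqrt_div (Nat.cast_nonneg _)]
  simp only [Finset.sum_const, nsmul_eq_mul]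
  rw [mul_one_div, div_right_comm, div_sqrt]

/-! ### Symmetrization: identical qubits are optimal -/

/-- Averaging two angles increases the symmetrized product of amplitudes. -/
theorem qubitAmp_pair_le (a b : ℝ) (j k : Fin 2) :
    qubitAmp a j * qubitAmp b k + qubitAmp a k * qubitAmp b j ≤
      2 * (qubitAmp ((a + b) / 2) j * qubitAmp ((a + b) / 2) k) := by
  set m := (a + b) / 2 with hm
  set d := (a - b) / 2 with hd
  have ea : a = m + d := by rw [hm, hd]; ring
  have eb : b = m - d := by rw [hm, hd]; ring
  have h1 := sin_sq_add_cos_sq m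
  have h2 := sin_sq_add_cos_sq d
  have h3 := mul_nonneg (sq_nonneg (cos m)) (sq_nonneg (sin d))
  have h4 := sq_nonneg (sin d)
  have h5 : cos m * sin m * (sin d ^ 2 + cos d ^ 2) = cos m * sin m := by rw [h2, mul_one]
  unfold qubitAmp
  rw [ea, eb, sin_add, cos_add, sin_sub, cos_sub]
  -- For j = k the product at a, b falls short of that at the mean by exactly sin² d; for j ≠ k both
  -- sides equal sin(a + b).
  fin_cases j <;> fin_cases k <;> simp <;> nlinarith

theorem prod_update_pair {ι : Type*} [Fintype ι] [DecidableEq ι] {i j : ι} (hij : i ≠ j)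
    (h : ι → ℝ → ℝ) (a : ι → ℝ) (s t : ℝ) :
    ∏ k, h k (Function.update (Function.update a i s) j t k) =
      h i s * h j t * ∏ k ∈ (Finset.univ.erase i).erase j, h k (a k) := by
  rw [← Finset.mul_prod_erase _ _ (Finset.mem_univ i),
    ← Finset.mul_prod_erase _ _ (Finset.mem_erase.2 ⟨hij.symm, Finset.mem_univ j⟩), ← mul_assoc]
  congr 1
  · simp [hij]
  · refine Finset.prod_congr rfl fun k hk => ?_
    simp only [Finset.mem_erase, Finset.mem_univ, and_true] at hk
    simp [hk.1, hk.2]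

theorem sum_update_pair {ι : Type*} [Fintype ι] [DecidableEq ι] {i j : ι} (hij : i ≠ j)
    (h : ℝ → ℝ) (a : ι → ℝ) (s t : ℝ) :
    ∑ k, h (Function.update (Function.update a i s) j t k) =
      h s + h t + ∑ k ∈ (Finset.univ.erase i).erase j, h (a k) := by
  rw [← Finset.add_sum_erase _ _ (Finset.mem_univ i),
    ← Finset.add_sum_erase _ _ (Finset.mem_erase.2 ⟨hij.symm, Finset.mem_univ j⟩), ← add_assoc]
  congr 1
  · simp [hij]
  · refine Finset.sum_congr rfl fun k hk => ?_
    simp only [Finset.mem_erase, Finset.mem_univ, and_true] at hk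
    simp [hk.1, hk.2]

theorem productAmp_pair_le {n : ℕ} {a : Fin n → ℝ} (ha : ∀ i, a i ∈ Icc 0 (π / 2))
    {i j : Fin n} (hij : i ≠ j) (x : Fin n → Fin 2) :
    productAmp a x + productAmp a (x ∘ Equiv.swap i j) ≤
      2 * productAmp (Function.update (Function.update a i ((a i + a j) / 2)) j
        ((a i + a j) / 2)) x := by
  have e : a = Function.update (Function.update a i (a i)) j (a j) := by simp
  have h1 := prod_update_pair hij (fun k s => qubitAmp s (x k)) a (a i) (a j)
  have h2 := prod_update_pair hij (fun k s => qubitAmp s ((x ∘ Equiv.swap i j) k)) a (a i) (a j)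
  have h3 := prod_update_pair hij (fun k s => qubitAmp s (x k)) a ((a i + a j) / 2)
    ((a i + a j) / 2)
  rw [← e] at h1 h2
  have h4 : ∏ k ∈ (Finset.univ.erase i).erase j, qubitAmp (a k) ((x ∘ Equiv.swap i j) k) =
      ∏ k ∈ (Finset.univ.erase i).erase j, qubitAmp (a k) (x k) := by
    refine Finset.prod_congr rfl fun k hk => ?_
    simp only [Finset.mem_erase, Finset.mem_univ, and_true] at hk
    simp [Equiv.swap_apply_of_ne_of_ne hk.2 hk.1]
  rw [h4] at h2
  simp only [Function.comp, Equiv.swap_apply_left, Equiv.swap_apply_right] at h2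
  unfold productAmp
  simp only [Function.comp]
  rw [h1, h2, h3, ← add_mul, ← mul_assoc]
  exact mul_le_mul_of_nonneg_right (qubitAmp_pair_le _ _ _ _)
    (Finset.prod_nonneg fun k _ => qubitAmp_nonneg (ha k) _)

/-- Membership in `S` is invariant under permutations of the qubits. -/
def IsSymmetricSet {n : ℕ} (S : Finset (Fin n → Fin 2)) : Prop :=
  ∀ (σ : Equiv.Perm (Fin n)) (x : Fin n → Fin 2), x ∘ σ ∈ S ↔ x ∈ S

theorem isSymmetricSet_of_isSymmetricState {n : ℕ} {S : Finset (Fin n → Fin 2)}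
    (hne : S.Nonempty) (h : IsSymmetricState (uniformSuperposition S)) : IsSymmetricSet S := by
  intro σ x
  have hM : √(S.card : ℝ) ≠ 0 := (sqrt_pos.2 (by exact_mod_cast hne.card_pos)).ne'
  have := h σ x
  simp only [uniformSuperposition] at this
  have hM' : ((1 / √(S.card : ℝ) : ℝ) : ℂ) ≠ 0 := by
    exact_mod_cast one_div_ne_zero hM
  by_cases h1 : x ∘ σ ∈ S <;> by_cases h2 : x ∈ S <;>
    simp only [h1, h2, if_true, if_false] at this ⊢
  · exact absurd this hM'
  · exact absurd this.symm hM'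

/-- The swap permutes S, so summing the pairwise inequality counts the original sum twice. -/
theorem sum_productAmp_pair_le {n : ℕ} {S : Finset (Fin n → Fin 2)} (hS : IsSymmetricSet S)
    {a : Fin n → ℝ} (ha : ∀ i, a i ∈ Icc 0 (π / 2)) {i j : Fin n} (hij : i ≠ j) :
    ∑ x ∈ S, productAmp a x ≤
      ∑ x ∈ S, productAmp (Function.update (Function.update a i ((a i + a j) / 2)) j
        ((a i + a j) / 2)) x := by
  have h1 : ∑ x ∈ S, productAmp a (x ∘ Equiv.swap i j) = ∑ x ∈ S, productAmp a x := by
    refine Finset.sum_nbij' (fun x => x ∘ Equiv.swap i j) (fun x => x ∘ Equiv.swap i j)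
      (fun x hx => (hS _ x).2 hx) (fun x hx => (hS _ x).2 hx) ?_ ?_ fun _ _ => rfl
    all_goals intro x _; funext k; simp
  have h2 := Finset.sum_le_sum fun x (_ : x ∈ S) => productAmp_pair_le ha hij x
  rw [Finset.sum_add_distrib, h1, ← Finset.mul_sum] at h2
  linarith

/-- Among the real product states with nonnegative amplitudes, a symmetric one has the largest
overlap with a symmetric uniform superposition. -/
theorem exists_const_sum_productAmp_le {n : ℕ} {S : Finset (Fin n → Fin 2)}
    (hS : IsSymmetricSet S) :
    ∃ c ∈ Icc 0 (π / 2), ∀ a : Fin n → ℝ, (∀ i, a i ∈ Icc 0 (π / 2)) →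
      ∑ x ∈ S, productAmp a x ≤ ∑ x ∈ S, productAmp (fun _ => c) x := by
  set F : (Fin n → ℝ) → ℝ := fun a => ∑ x ∈ S, productAmp a x with hF
  have hq : ∀ j, Continuous fun s => qubitAmp s j := by
    intro j
    unfold qubitAmp
    split_ifs <;> fun_prop
  have hcont : Continuous F := by
    refine continuous_finsetSum _ fun x _ => continuous_finsetProd _ fun i _ => ?_
    exact (hq (x i)).comp (continuous_apply i)
  have hcomp : IsCompact (Set.pi Set.univ fun _ : Fin n => Icc (0 : ℝ) (π / 2)) :=
    isCompact_univ_pi fun _ => isCompact_Icc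
  have h0 : (0 : ℝ) ∈ Icc 0 (π / 2) := ⟨le_rfl, by positivity⟩
  obtain ⟨a₀, ha₀, hmax⟩ := hcomp.exists_isMaxOn ⟨fun _ => 0, fun _ _ => h0⟩ hcont.continuousOn
  -- Among the maximizers, take one with the least sum of squares. Averaging two unequal angles
  -- would preserve maximality and strictly lower that sum, so all angles agree.
  have hcomp' := hcomp.inter_right (isClosed_eq hcont (continuous_const (y := F a₀)))
  obtain ⟨a, ⟨ha, haF⟩, hmin⟩ := hcomp'.exists_isMinOn (f := fun a => ∑ i, a i ^ 2)
    ⟨a₀, ha₀, rfl⟩ (by fun_prop)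
  have haF : F a = F a₀ := haF
  have hconst : ∀ i j, a i = a j := by
    intro i j
    by_contra hne
    have hij : i ≠ j := fun h => hne (by rw [h])
    set m := (a i + a j) / 2 with hm
    set a' := Function.update (Function.update a i m) j m with ha'
    have hmem : a' ∈ Set.pi Set.univ fun _ : Fin n => Icc (0 : ℝ) (π / 2) := by
      have hi := ha i (Set.mem_univ i)
      have hj := ha j (Set.mem_univ j)
      have hmm : m ∈ Icc 0 (π / 2) :=
        ⟨by linarith [hi.1, hj.1], by linarith [hi.2, hj.2]⟩
      intro k _
      simp only [ha', Function.update_apply]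
      split_ifs
      · exact hmm
      · exact hmm
      · exact ha k (Set.mem_univ k)
    have hle : F a ≤ F a' := sum_productAmp_pair_le hS (fun i => ha i (Set.mem_univ i)) hij
    have hle' : F a' ≤ F a₀ := hmax hmem
    have h1 : ∑ k, a k ^ 2 ≤ ∑ k, a' k ^ 2 := hmin ⟨hmem, le_antisymm hle' (haF ▸ hle)⟩
    have h2 := sum_update_pair hij (fun s => s ^ 2) a m m
    have h3 := sum_update_pair hij (fun s => s ^ 2) a (a i) (a j)
    rw [show Function.update (Function.update a i (a i)) j (a j) = a by simp] at h3
    have h4 : 0 < (a i - a j) ^ 2 := by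
      have := sub_ne_zero.2 hne
      positivity
    have h5 : m ^ 2 + m ^ 2 = a i ^ 2 + a j ^ 2 - (a i - a j) ^ 2 / 2 := by rw [hm]; ring
    linarith
  have hex : ∃ c ∈ Icc 0 (π / 2), a = fun _ => c := by
    rcases isEmpty_or_nonempty (Fin n) with h | ⟨⟨i⟩⟩
    · exact ⟨0, h0, Subsingleton.elim _ _⟩
    · exact ⟨a i, ha i (Set.mem_univ i), funext fun j => hconst j i⟩
  obtain ⟨c, hc, rfl⟩ := hex
  refine ⟨c, hc, fun a' ha' => ?_⟩
  have : F a' ≤ F a₀ := hmax fun i _ => ha' i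
  exact this.trans haF.ge

/-! ### The maximal overlap with the marked superposition -/

theorem continuous_B (n : ℕ) (w : Multiset ℕ) : Continuous (B n w) := by
  unfold B
  exact continuous_const.mul (continuous_multiset_sum w fun m _ => by fun_prop)

theorem isGreatest_Bmax {n : ℕ} (w : Multiset ℕ) :
    IsGreatest (B n w '' Icc 0 π) (Bmax n w) :=
  (isCompact_Icc.image (continuous_B n w)).isGreatest_sSup
    ⟨_, 0, ⟨le_rfl, pi_pos.le⟩, rfl⟩

theorem half_mem_Icc {α : ℝ} (h : α ∈ Icc 0 π) : α / 2 ∈ Icc 0 (π / 2) :=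
  ⟨by linarith [h.1], by linarith [h.2]⟩

theorem exists_overlap_eq_Bmax {n : ℕ} (S : Finset (Fin n → Fin 2)) :
    ∃ a : Fin n → ℝ, (∀ i, a i ∈ Icc 0 (π / 2)) ∧ overlap S a = Bmax n (weights S) := by
  obtain ⟨α, hα, h⟩ := (isGreatest_Bmax (n := n) (weights S)).1
  exact ⟨fun _ => α / 2, fun _ => half_mem_Icc hα, by rw [overlap_const, h]⟩

theorem overlap_le_Bmax {n : ℕ} {S : Finset (Fin n → Fin 2)} (hS : IsSymmetricSet S)
    {a : Fin n → ℝ} (ha : ∀ i, a i ∈ Icc 0 (π / 2)) : overlap S a ≤ Bmax n (weights S) := by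
  obtain ⟨c, hc, h⟩ := exists_const_sum_productAmp_le hS
  have h1 : overlap S a ≤ overlap S fun _ => c :=
    div_le_div_of_nonneg_right (h a ha) (sqrt_nonneg _)
  have h2 := (isGreatest_Bmax (n := n) (weights S)).2
    ⟨2 * c, ⟨by linarith [hc.1], by linarith [hc.2]⟩, rfl⟩
  rw [← overlap_const, mul_div_cancel_left₀ _ two_ne_zero] at h2
  exact h1.trans h2

theorem Bmax_le_one {n : ℕ} (S : Finset (Fin n → Fin 2)) : Bmax n (weights S) ≤ 1 := by
  obtain ⟨a, -, h⟩ := exists_overlap_eq_Bmax S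
  exact h ▸ overlap_le_one S a

/-- The value of `B` at α = π/2 is √(M/N). -/
theorem Bmax_pos {n : ℕ} {S : Finset (Fin n → Fin 2)} (hS : S.Nonempty) :
    0 < Bmax n (weights S) := by
  have h := (isGreatest_Bmax (n := n) (weights S)).2
    ⟨π / 2, ⟨by positivity, by linarith [pi_pos]⟩, rfl⟩
  rw [← overlap_const, show π / 2 / 2 = π / 4 by ring, overlap_pi_div_four] at h
  refine lt_of_lt_of_le (sqrt_pos.2 ?_) h
  have : 0 < (S.card : ℝ) := by exact_mod_cast hS.card_pos
  positivity


/-! ### Grover iteration as a rotation -/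

/-- The state `cos t |S₀⟩ + sin t |S₁⟩` in the plane spanned by the uniform superpositions of the
unmarked and of the marked basis states. -/
def planeState {n : ℕ} (S : Finset (Fin n → Fin 2)) (t : ℝ) : Register n :=
  WithLp.toLp 2 fun x => if x ∈ S then ((sin t / √(S.card : ℝ) : ℝ) : ℂ)
    else ((cos t / √(Sᶜ.card : ℝ) : ℝ) : ℂ)

theorem sqrt_card_pos {n : ℕ} {S : Finset (Fin n → Fin 2)} (hS : S.Nonempty) :
    0 < √(S.card : ℝ) := sqrt_pos.2 (by exact_mod_cast hS.card_pos)

theorem card_add_card_compl {n : ℕ} (S : Finset (Fin n → Fin 2)) :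
    (S.card : ℝ) + Sᶜ.card = 2 ^ n := by
  have := Finset.card_add_card_compl S
  simp only [Fintype.card_pi, Fintype.card_fin, Finset.prod_const, Finset.card_univ] at this
  exact_mod_cast this

theorem sin_baseAngle {n : ℕ} (S : Finset (Fin n → Fin 2)) :
    sin (baseAngle S) = √(S.card / 2 ^ n) := by
  refine sin_arcsin (by linarith [sqrt_nonneg ((S.card : ℝ) / 2 ^ n)]) (sqrt_le_one.2 ?_)
  rw [div_le_one (by positivity), ← card_add_card_compl S]
  linarith [Nat.cast_nonneg (α := ℝ) Sᶜ.card]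

theorem cos_baseAngle {n : ℕ} (S : Finset (Fin n → Fin 2)) :
    cos (baseAngle S) = √(Sᶜ.card / 2 ^ n) := by
  have hp : (0 : ℝ) < 2 ^ n := by positivity
  rw [baseAngle, cos_arcsin, sq_sqrt (by positivity)]
  congr 1
  field_simp
  linarith [card_add_card_compl S]

theorem sum_ite_mem_eq {n : ℕ} (S : Finset (Fin n → Fin 2)) {E : Type*} [AddCommMonoid E]
    (f g : (Fin n → Fin 2) → E) :
    ∑ x, (if x ∈ S then f x else g x) = ∑ x ∈ S, f x + ∑ x ∈ Sᶜ, g x := by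
  rw [← Finset.sum_add_sum_compl S]
  congr 1
  · exact Finset.sum_congr rfl fun x hx => by simp [hx]
  · exact Finset.sum_congr rfl fun x hx => by simp [Finset.mem_compl.1 hx]

theorem initialState_eq_planeState {n : ℕ} {S : Finset (Fin n → Fin 2)} (hS : S.Nonempty)
    (hS' : Sᶜ.Nonempty) : initialState n = planeState S (baseAngle S) := by
  have h1 := sqrt_card_pos hS
  have h2 := sqrt_card_pos hS'
  ext x
  simp only [initialState, uniformSuperposition, planeState, sin_baseAngle, cos_baseAngle,
    sqrt_div (Nat.cast_nonneg _), Finset.mem_univ, if_true]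
  split_ifs
  · congr 1
    simp
    field_simp
  · congr 1
    simp
    field_simp

theorem inner_initialState_oracle {n : ℕ} {S : Finset (Fin n → Fin 2)} (hS : S.Nonempty)
    (hS' : Sᶜ.Nonempty) (t : ℝ) :
    inner ℂ (initialState n) (oracle S (planeState S t)) = ((cos (t + baseAngle S) : ℝ) : ℂ) := by
  have h1 := sqrt_card_pos hS
  have h2 := sqrt_card_pos hS'
  have h3 : ∀ x, inner ℂ (initialState n x) (oracle S (planeState S t) x) =
      if x ∈ S then ((-(sin t / √(S.card : ℝ) / √(2 ^ n)) : ℝ) : ℂ)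
      else ((cos t / √(Sᶜ.card : ℝ) / √(2 ^ n) : ℝ) : ℂ) := by
    intro x
    have h0 : initialState n x = ((1 / √(2 ^ n) : ℝ) : ℂ) := by
      simp [initialState, uniformSuperposition]
    rw [h0]
    simp only [planeState, oracle]
    split_ifs
    · simp only [RCLike.inner_apply, Complex.conj_ofReal]
      norm_cast
      ring
    · simp only [RCLike.inner_apply, Complex.conj_ofReal]
      norm_cast
      ring
  rw [PiLp.inner_apply, Finset.sum_congr rfl fun x _ => h3 x, sum_ite_mem_eq]
  simp only [Finset.sum_const, nsmul_eq_mul]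
  norm_cast
  rw [cos_add, cos_baseAngle, sin_baseAngle, sqrt_div (Nat.cast_nonneg _),
    sqrt_div (Nat.cast_nonneg _)]
  have e : ∀ (c : ℕ) (s : ℝ), (c : ℝ) * (s / √(c : ℝ) / √(2 ^ n)) = √(c : ℝ) * s / √(2 ^ n) := by
    intro c s
    calc _ = (c : ℝ) / √(c : ℝ) * s / √(2 ^ n) := by ring
      _ = _ := by rw [div_sqrt]
  have e3 := e S.card (sin t)
  have e4 := e Sᶜ.card (cos t)
  push_cast at e3 e4 ⊢
  rw [mul_neg, e3, e4]
  ring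

/-- The oracle reflects the angle t to -t, and the reflection about the initial state, at angle θ,
sends -t to t + 2θ. -/
theorem groverOp_planeState {n : ℕ} {S : Finset (Fin n → Fin 2)} (hS : S.Nonempty)
    (hS' : Sᶜ.Nonempty) (t : ℝ) :
    groverOp S (planeState S t) = planeState S (t + 2 * baseAngle S) := by
  have h1 := sqrt_card_pos hS
  have h2 := sqrt_card_pos hS'
  have hsc := sin_sq_add_cos_sq (baseAngle S)
  rw [groverOp, inner_initialState_oracle hS hS', initialState_eq_planeState hS hS']
  ext x
  simp only [planeState, oracle, PiLp.sub_apply, PiLp.smul_apply, smul_eq_mul]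
  split_ifs
  · norm_cast
    rw [sin_add, cos_add, sin_two_mul, cos_two_mul', ← mul_div_assoc, sub_neg_eq_add, ← add_div]
    congr 1
    linear_combination (- sin t) * hsc
  · norm_cast
    rw [cos_add, cos_add, sin_two_mul, cos_two_mul', ← mul_div_assoc, ← sub_div]
    congr 1
    linear_combination (cos t) * hsc

theorem groverState_eq_planeState {n : ℕ} {S : Finset (Fin n → Fin 2)} (hS : S.Nonempty)
    (hS' : Sᶜ.Nonempty) (k : ℕ) : groverState S k = planeState S (angle S k) := by
  induction k with
  | zero => simp [groverState, angle, initialState_eq_planeState hS hS']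
  | succ k ih =>
    rw [groverState, Function.iterate_succ_apply', ← groverState, ih, groverOp_planeState hS hS']
    congr 1
    simp only [angle]
    push_cast
    ring

/-! ### Reduction of the GME to real product states -/

theorem exists_angle_norm_eq {q : Qubit} (hq : ‖q‖ = 1) :
    ∃ a ∈ Icc 0 (π / 2), ∀ j, ‖q j‖ = qubitAmp a j := by
  have h : ‖q 0‖ ^ 2 + ‖q 1‖ ^ 2 = 1 := by
    have := EuclideanSpace.norm_sq_eq q
    rw [hq, Fin.sum_univ_two] at this
    linarith
  have h0 := norm_nonneg (q 0)
  have h1 := norm_nonneg (q 1)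
  refine ⟨arcsin ‖q 1‖, ⟨arcsin_nonneg.2 h1, arcsin_le_pi_div_two _⟩, fun j => ?_⟩
  fin_cases j
  · simp only [qubitAmp, cos_arcsin]
    simp
    rw [← sqrt_sq h0]
    congr 1
    linarith
  · simp only [qubitAmp]
    simp
    rw [sin_arcsin (by linarith) (by nlinarith)]

theorem inner_planeState {n : ℕ} (S : Finset (Fin n → Fin 2)) (t : ℝ) (φ : Register n) :
    inner ℂ (planeState S t) φ = ∑ x ∈ S, ((sin t / √(S.card : ℝ) : ℝ) : ℂ) * φ x +
      ∑ x ∈ Sᶜ, ((cos t / √(Sᶜ.card : ℝ) : ℝ) : ℂ) * φ x := by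
  rw [PiLp.inner_apply, ← sum_ite_mem_eq]
  refine Finset.sum_congr rfl fun x _ => ?_
  simp only [planeState]
  split_ifs <;> simp only [RCLike.inner_apply, Complex.conj_ofReal, mul_comm]

/-- The triangle inequality replaces amplitudes by their moduli. When cos t and sin t are
nonnegative, real qubits attain the bound, by `inner_planeState_real`. -/
theorem norm_inner_planeState_le {n : ℕ} (S : Finset (Fin n → Fin 2)) (t : ℝ)
    {q : Fin n → Qubit} {a : Fin n → ℝ} (h : ∀ i j, ‖q i j‖ = qubitAmp (a i) j) :
    ‖inner ℂ (planeState S t) (productState q)‖ ≤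
      |cos t| * overlap Sᶜ a + |sin t| * overlap S a := by
  have hn : ∀ x, ‖productState q x‖ = productAmp a x := by
    intro x
    simp [productState, productAmp, h]
  have hb : ∀ (T : Finset (Fin n → Fin 2)) (s : ℝ),
      ‖∑ x ∈ T, ((s / √(T.card : ℝ) : ℝ) : ℂ) * productState q x‖ ≤ |s| * overlap T a := by
    intro T s
    refine (norm_sum_le _ _).trans (le_of_eq ?_)
    simp only [norm_mul, hn, Complex.norm_real, ← Finset.mul_sum, overlap, norm_div,
      Real.norm_eq_abs, abs_of_nonneg (sqrt_nonneg _)]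
    ring
  rw [inner_planeState, add_comm]
  exact (norm_add_le _ _).trans (add_le_add (hb _ _) (hb _ _))

theorem inner_planeState_real {n : ℕ} (S : Finset (Fin n → Fin 2)) (t : ℝ) (a : Fin n → ℝ) :
    inner ℂ (planeState S t)
      (productState fun i => WithLp.toLp 2 fun j => ((qubitAmp (a i) j : ℝ) : ℂ)) =
      ((cos t * overlap Sᶜ a + sin t * overlap S a : ℝ) : ℂ) := by
  have hn : ∀ x, productState (fun i => WithLp.toLp 2 fun j => ((qubitAmp (a i) j : ℝ) : ℂ)) x =
      ((productAmp a x : ℝ) : ℂ) := by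
    intro x
    simp [productState, productAmp]
  rw [inner_planeState]
  simp only [hn, ← Finset.mul_sum, overlap]
  push_cast
  ring

theorem norm_real_qubit (a : ℝ) :
    ‖(WithLp.toLp 2 fun j => ((qubitAmp a j : ℝ) : ℂ) : Qubit)‖ = 1 := by
  rw [EuclideanSpace.norm_eq, Fin.sum_univ_two]
  simp only [Complex.norm_real, Real.norm_eq_abs, sq_abs]
  simp [qubitAmp]

theorem le_one_sub_gme {n : ℕ} (S : Finset (Fin n → Fin 2)) (t : ℝ) (a : Fin n → ℝ) :
    (cos t * overlap Sᶜ a + sin t * overlap S a) ^ 2 ≤ 1 - gme (planeState S t) := by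
  rw [gme, sub_sub_cancel]
  refine (isGreatest_separableOverlaps _).2 ⟨_, fun i => norm_real_qubit (a i), ?_⟩
  rw [inner_planeState_real, Complex.norm_real, Real.norm_eq_abs, sq_abs]

theorem exists_one_sub_gme_le {n : ℕ} (S : Finset (Fin n → Fin 2)) (t : ℝ) :
    ∃ a : Fin n → ℝ, (∀ i, a i ∈ Icc 0 (π / 2)) ∧
      1 - gme (planeState S t) ≤ (|cos t| * overlap Sᶜ a + |sin t| * overlap S a) ^ 2 := by
  obtain ⟨q, hq, h⟩ := (isGreatest_separableOverlaps (planeState S t)).1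
  choose a ha haq using fun i => exists_angle_norm_eq (hq i)
  refine ⟨a, ha, ?_⟩
  rw [gme, sub_sub_cancel, h]
  exact pow_le_pow_left₀ (norm_nonneg _) (norm_inner_planeState_le S t haq) 2


/-! ### Entanglement curve of a planar overlap region -/

/-- The properties of the set of overlaps of the product states with the unmarked and the marked
superposition on which the shape of the entanglement curve depends. -/
structure IsOverlapRegion (K : Set (ℝ × ℝ)) (b θ δ : ℝ) : Prop where
  fst_nonneg : ∀ p ∈ K, 0 ≤ p.1
  fst_le : ∀ p ∈ K, p.1 ≤ 1
  snd_nonneg : ∀ p ∈ K, 0 ≤ p.2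
  snd_le : ∀ p ∈ K, p.2 ≤ b
  small : ∀ p ∈ K, p.1 ≤ δ ∨ p.2 ≤ δ
  initial_mem : (cos θ, sin θ) ∈ K
  exists_snd_eq : ∃ p ∈ K, p.2 = b
  pos : 0 < b
  le_one : b ≤ 1
  angle_pos : 0 < θ
  angle_le : θ ≤ δ

/-- `E` is one minus the largest squared overlap, over the region `K`, of the state at angle `t`;
for `t > π/2` it is only bounded from both sides. -/
def IsRegionGme (K : Set (ℝ × ℝ)) (t E : ℝ) : Prop :=
  (∃ p ∈ K, 1 - E ≤ (|cos t| * p.1 + |sin t| * p.2) ^ 2) ∧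
    ∀ p ∈ K, (cos t * p.1 + sin t * p.2) ^ 2 ≤ 1 - E

theorem half_le_sin {x : ℝ} (h0 : 0 ≤ x) (h1 : x ≤ π / 2) : x / 2 ≤ sin x := by
  have h := mul_le_sin h0 h1
  have : 1 / 2 ≤ 2 / π := by
    rw [div_le_div_iff₀ two_pos pi_pos]
    linarith [pi_le_four]
  nlinarith

theorem half_le_sin_of_le_pi_sub {x y : ℝ} (hy0 : 0 ≤ y) (h0 : y ≤ x)
    (h1 : x ≤ π - y) : y / 2 ≤ sin x := by
  rcases le_total x (π / 2) with h | h
  · linarith [half_le_sin (hy0.trans h0) h]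
  · have := half_le_sin (x := π - x) (by linarith) (by linarith)
    rw [sin_pi_sub] at this
    linarith

theorem sin_sq_sub_sin_sq' (t t' : ℝ) :
    sin t' ^ 2 - sin t ^ 2 = sin (t' - t) * sin (t' + t) := by
  rw [sin_sub, sin_add]
  linear_combination (-(sin t' ^ 2)) * sin_sq_add_cos_sq t + sin t ^ 2 * sin_sq_add_cos_sq t'

theorem abs_sin_sq_sub_sin_sq_le (t t' : ℝ) : |sin t' ^ 2 - sin t ^ 2| ≤ |t' - t| := by
  rw [sin_sq_sub_sin_sq', abs_mul]
  calc _ ≤ |t' - t| * 1 :=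
        mul_le_mul abs_sin_le_abs (abs_sin_le_one _) (abs_nonneg _) (abs_nonneg _)
    _ = _ := mul_one _

theorem sin_sq_add_le {ε t t' : ℝ} (hε : 0 < ε) (ht : 0 ≤ t) (htt : t + ε ≤ t')
    (ht' : t' ≤ π / 2) : sin t ^ 2 + ε ^ 2 / 4 ≤ sin t' ^ 2 := by
  have h1 := half_le_sin (x := t' - t) (by linarith) (by linarith)
  have h2 := half_le_sin_of_le_pi_sub (x := t' + t) (y := ε) hε.le (by linarith)
    (by linarith)
  have h3 := sin_sq_sub_sin_sq' t t'
  have h4 := mul_le_mul (show ε / 2 ≤ sin (t' - t) by linarith) h2 (by positivity)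
    (by linarith)
  nlinarith

section turning

variable {b : ℝ}

theorem arctan_inv_pos (hb : 0 < b) : 0 < arctan (1 / b) := arctan_pos.2 (by positivity)

theorem pi_div_four_le_arctan_inv (hb : 0 < b) (hb1 : b ≤ 1) : π / 4 ≤ arctan (1 / b) := by
  rw [← arctan_one]
  exact arctan_mono ((one_le_div hb).2 hb1)

theorem sin_arctan_inv_pos (hb : 0 < b) : 0 < sin (arctan (1 / b)) :=
  sin_pos_of_pos_of_lt_pi (arctan_inv_pos hb) (by linarith [arctan_lt_pi_div_two (1 / b), pi_pos])

theorem cos_arctan_inv (hb : 0 < b) :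
    cos (arctan (1 / b)) = sin (arctan (1 / b)) * b := by
  have hc := cos_arctan_pos (1 / b)
  have h := tan_eq_sin_div_cos (arctan (1 / b))
  rw [tan_arctan, div_eq_div_iff hb.ne' hc.ne'] at h
  linarith

theorem sin_arctan_inv_sub (hb : 0 < b) (t : ℝ) :
    sin (arctan (1 / b) - t) = sin (arctan (1 / b)) * (cos t - b * sin t) := by
  rw [sin_sub, cos_arctan_inv hb]; ring

/-- The identity sin(θ_T - t) = sin θ_T (cos t - b sin t) and sin θ_T ≤ 1 turn a distance from the
turning point into a gap between the branches. -/
theorem half_le_cos_sub {ε t : ℝ} (hb : 0 < b) (hε : 0 ≤ ε) (ht : 0 ≤ t)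
    (h : t + ε ≤ arctan (1 / b)) : ε / 2 ≤ cos t - b * sin t := by
  have h1 := half_le_sin (x := arctan (1 / b) - t) (by linarith)
    (by linarith [arctan_lt_pi_div_two (1 / b)])
  rw [sin_arctan_inv_sub hb] at h1
  have h2 := sin_arctan_inv_pos hb
  have h3 := sin_le_one (arctan (1 / b))
  by_contra! h4
  rcases le_total 0 (cos t - b * sin t) with h5 | h5 <;> nlinarith

theorem half_le_sin_sub {ε t : ℝ} (hb : 0 < b) (hε : 0 ≤ ε)
    (h : arctan (1 / b) + ε ≤ t) (ht : t ≤ π / 2) : ε / 2 ≤ b * sin t - cos t := by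
  have h0 := arctan_inv_pos hb
  have h1 := half_le_sin (x := t - arctan (1 / b)) (by linarith) (by linarith)
  rw [← neg_sub, sin_neg, sin_arctan_inv_sub hb] at h1
  have h2 := sin_arctan_inv_pos hb
  have h3 := sin_le_one (arctan (1 / b))
  by_contra! h4
  rcases le_total 0 (b * sin t - cos t) with h5 | h5 <;> nlinarith

/-- Above the turning point, the curve `sin² t * b²` grows by a definite amount. -/
theorem sin_sq_mul_add_le {ε θ t t' : ℝ} (hb : 0 < b) (hb1 : b ≤ 1) (hε : 0 < ε) (hε1 : ε ≤ 1 / 2)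
    (hθ' : θ ≤ ε / 4) (ht : arctan (1 / b) ≤ t) (htt : t + ε ≤ t')
    (ht' : t' ≤ π / 2 + θ) : sin t ^ 2 * b ^ 2 + ε ^ 4 / 32 ≤ sin t' ^ 2 * b ^ 2 := by
  have hπ := pi_gt_three
  have h4 := pi_div_four_le_arctan_inv hb hb1
  -- This bound makes the gain uniform in b: since θ_T = π/2 - arctan b, a smaller b would leave no
  -- room for a step of length ε between θ_T and π/2 + θ.
  have hbε : ε / 2 ≤ b := by
    have h1 : arctan (1 / b) = π / 2 - arctan b := by
      rw [one_div, arctan_inv_of_pos hb]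
    have h2 : arctan b ≤ b := by
      simpa using le_tan (arctan_pos.2 hb).le (arctan_lt_pi_div_two b)
    linarith
  have h1 := half_le_sin (x := t' - t) (by linarith) (by linarith)
  have h2 := half_le_sin_of_le_pi_sub (x := t' + t) (y := ε / 2) (by linarith) (by linarith)
    (by linarith)
  have h3 := sin_sq_sub_sin_sq' t t'
  have h5 := mul_le_mul (show ε / 2 ≤ sin (t' - t) by linarith) h2 (by positivity)
    (by linarith)
  have h6 : (ε / 2) ^ 2 ≤ b ^ 2 := by gcongr
  have h7 : ε ^ 2 / 8 ≤ sin t' ^ 2 - sin t ^ 2 := by rw [h3]; linarith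
  have h8 := mul_le_mul h7 h6 (by positivity) (by linarith [sq_nonneg ε])
  nlinarith

end turning

namespace IsOverlapRegion

variable {K : Set (ℝ × ℝ)} {b θ δ : ℝ}

/-- At the optimal pair one coordinate is at most δ, so the overlap exceeds one branch by at most δ;
squaring costs 2δ + δ² ≤ 3δ. -/
theorem one_sub_le (hK : IsOverlapRegion K b θ δ) (hδ : δ ≤ 1) {t E : ℝ} (hs : 0 ≤ sin t)
    (hE : IsRegionGme K t E) : 1 - E ≤ cos t ^ 2 + 3 * δ ∨ 1 - E ≤ sin t ^ 2 * b ^ 2 + 3 * δ := by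
  obtain ⟨⟨p, hp, h⟩, -⟩ := hE
  rw [abs_of_nonneg hs] at h
  have h1 := hK.fst_nonneg p hp
  have h2 := hK.snd_nonneg p hp
  have h3 := hK.fst_le p hp
  have h4 := hK.snd_le p hp
  have hc := abs_cos_le_one t
  have hc0 := abs_nonneg (cos t)
  have hs1 := sin_le_one t
  have hb := hK.le_one
  have hb0 := hK.pos
  have hδ0 := hK.angle_pos.trans_le hK.angle_le
  have key : ∀ y : ℝ, y ≤ 1 → |cos t| * p.1 + sin t * p.2 ≤ y + δ →
      1 - E ≤ y ^ 2 + 3 * δ := by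
    intro y hy1 hle
    have := pow_le_pow_left₀ (by positivity) hle 2
    nlinarith
  rcases hK.small p hp with h5 | h5
  · right
    rw [← mul_pow]
    refine key _ (by nlinarith) ?_
    have e1 : |cos t| * p.1 ≤ 1 * δ := mul_le_mul hc h5 h1 (by norm_num)
    have e2 : sin t * p.2 ≤ sin t * b := mul_le_mul_of_nonneg_left h4 hs
    linarith
  · left
    rw [← sq_abs]
    refine key _ hc ?_
    have e1 : |cos t| * p.1 ≤ |cos t| * 1 := mul_le_mul_of_nonneg_left h3 hc0
    have e2 : sin t * p.2 ≤ 1 * δ := mul_le_mul hs1 h5 h2 (by norm_num)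
    linarith

/-- The initial product state has overlap cos(t - θ), and moving the angle by θ changes cos² by at
most θ ≤ δ. -/
theorem cos_sq_le (hK : IsOverlapRegion K b θ δ) {t E : ℝ} (hE : IsRegionGme K t E) :
    cos t ^ 2 ≤ 1 - E + δ := by
  have h := hE.2 _ hK.initial_mem
  simp only [← cos_sub] at h
  have h1 := (abs_le.1 (abs_sin_sq_sub_sin_sq_le t (t - θ))).2
  rw [show t - θ - t = -θ by ring, abs_neg, abs_of_pos hK.angle_pos] at h1
  have h2 := hK.angle_le
  linarith [sin_sq_add_cos_sq t, sin_sq_add_cos_sq (t - θ)]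

/-- Needed because the last iteration may overshoot π/2 by up to θ. -/
theorem neg_angle_le_cos {t : ℝ} (hθ : 0 ≤ θ) (ht : 0 ≤ t) (ht' : t ≤ π / 2 + θ) :
    -θ ≤ cos t := by
  rcases le_total t (π / 2) with h | h
  · linarith [cos_nonneg_of_mem_Icc ⟨by linarith [pi_pos], h⟩]
  · have h1 := sin_le (x := t - π / 2) (by linarith)
    rw [sin_sub_pi_div_two] at h1
    linarith

/-- Test with a pair whose second coordinate is b. Past π/2 its first coordinate may count
negatively, but by at most θ, which costs at most 2θ after squaring. -/
theorem sin_sq_mul_le (hK : IsOverlapRegion K b θ δ) {t E : ℝ} (hs : 0 ≤ sin t)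
    (hc : -θ ≤ cos t) (hE : IsRegionGme K t E) : sin t ^ 2 * b ^ 2 ≤ 1 - E + 2 * δ := by
  obtain ⟨p, hp, hpb⟩ := hK.exists_snd_eq
  have h := hE.2 p hp
  rw [hpb] at h
  have h1 := hK.fst_nonneg p hp
  have h3 := hK.fst_le p hp
  have hθ := hK.angle_le
  have hθ0 := hK.angle_pos
  have e1 : -θ ≤ cos t * p.1 := by nlinarith
  have hb := hK.le_one
  have hb0 := hK.pos
  have hsb : 0 ≤ sin t * b := by positivity
  have hsb1 : sin t * b ≤ 1 := by nlinarith [sin_le_one t]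
  nlinarith [sq_nonneg (cos t * p.1)]

theorem sin_nonneg_of_le (hθ' : θ ≤ 1) {t : ℝ} (ht : 0 ≤ t)
    (ht' : t ≤ π / 2 + θ) : 0 ≤ sin t :=
  sin_nonneg_of_nonneg_of_le_pi ht (by linarith [pi_gt_three])

theorem abs_sub_sin_sq_le (hK : IsOverlapRegion K b θ δ) (hδ : δ ≤ 1) {t E : ℝ} (ht : 0 ≤ t)
    (ht' : t ≤ arctan (1 / b)) (hE : IsRegionGme K t E) : |E - sin t ^ 2| ≤ 6 * δ := by
  have hδ0 := hK.angle_pos.trans_le hK.angle_le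
  have hlt := arctan_lt_pi_div_two (1 / b)
  have hs := sin_nonneg_of_le (θ := θ) (hK.angle_le.trans hδ) ht
    (by linarith [hK.angle_pos])
  have h1 := hK.cos_sq_le hE
  have h2 : (sin t * b) ^ 2 ≤ cos t ^ 2 := by
    have := half_le_cos_sub (ε := 0) hK.pos le_rfl ht (by linarith)
    have hb := hK.pos
    exact pow_le_pow_left₀ (by positivity) (by linarith) 2
  have h3 := sin_sq_add_cos_sq t
  rw [abs_le]
  rw [mul_pow] at h2
  rcases hK.one_sub_le hδ hs hE with h | h <;> constructor <;> linarith

theorem abs_sub_one_sub_le (hK : IsOverlapRegion K b θ δ) (hδ : δ ≤ 1) {t E : ℝ}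
    (ht : arctan (1 / b) ≤ t) (ht' : t ≤ π / 2 + θ) (hE : IsRegionGme K t E) :
    |E - (1 - sin t ^ 2 * b ^ 2)| ≤ 6 * δ := by
  have hδ0 := hK.angle_pos.trans_le hK.angle_le
  have ht0 := (arctan_inv_pos hK.pos).le.trans ht
  have hs := sin_nonneg_of_le (hK.angle_le.trans hδ) ht0 ht'
  have hc := neg_angle_le_cos hK.angle_pos.le ht0 ht'
  have h1 := hK.sin_sq_mul_le hs hc hE
  have h2 : cos t ^ 2 ≤ sin t ^ 2 * b ^ 2 + δ := by
    -- Past π/2, cos² t ≤ θ² ≤ δ; before it the second branch dominates.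
    rcases le_total (cos t) 0 with h | h
    · nlinarith [hK.angle_le, mul_nonneg (sq_nonneg (sin t)) (sq_nonneg b), hK.angle_pos]
    · have htp : t ≤ π / 2 := by
        by_contra! h5
        have := cos_neg_of_pi_div_two_lt_of_lt h5
          (by linarith [hK.angle_le, pi_gt_three])
        linarith
      have := half_le_sin_sub (ε := 0) hK.pos le_rfl (by linarith) htp
      rw [← mul_pow]
      nlinarith [pow_le_pow_left₀ h (show cos t ≤ sin t * b by linarith) 2]
  rw [abs_le]
  rcases hK.one_sub_le hδ hs hE with h | h <;> constructor <;> linarith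

/-- No lower bound on t' - t is available, so the branch estimates are too coarse. The pair optimal
at t' has p.2 tiny, and this same pair does strictly better at t. -/
theorem lt_of_lt_turning (hK : IsOverlapRegion K b θ δ) {ε : ℝ} (hε : 0 < ε) (hε1 : ε ≤ 1 / 2)
    (hδ : δ ≤ ε ^ 4 / 1000) {t t' E E' : ℝ} (ht : ε ≤ t) (htt : t < t')
    (ht' : t' ≤ arctan (1 / b) - ε) (hE : IsRegionGme K t E) (hE' : IsRegionGme K t' E') :
    E < E' := by
  have hlt := arctan_lt_pi_div_two (1 / b)
  have hθ := hK.angle_le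
  have hθ0 := hK.angle_pos
  have hδε : δ < ε ^ 2 / 8 := by
    have h1 : 0 < ε ^ 2 := by positivity
    have h2 : ε ^ 2 ≤ 1 / 4 := by nlinarith
    nlinarith
  have hδε' : δ < ε / 8 := by nlinarith
  obtain ⟨p, hp, h⟩ := hE'.1
  have hs : 0 ≤ sin t' := sin_nonneg_of_nonneg_of_le_pi (by linarith) (by linarith [pi_pos])
  have hc : 0 ≤ cos t' := cos_nonneg_of_mem_Icc ⟨by linarith [pi_pos], by linarith⟩
  rw [abs_of_nonneg hs, abs_of_nonneg hc] at h
  have h1 := hK.fst_nonneg p hp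
  have h2 := hK.snd_nonneg p hp
  have h4 := hK.snd_le p hp
  have hb := hK.pos
  have h5 : cos (t' - θ) ≤ cos t' * p.1 + sin t' * p.2 := by
    have h6 := hE'.2 _ hK.initial_mem
    simp only [← cos_sub] at h6
    exact le_of_sq_le_sq (h6.trans h) (by positivity)
  have h6 : cos t' ≤ cos (t' - θ) := cos_le_cos_of_nonneg_of_le_pi
    (by nlinarith) (by linarith [pi_pos]) (by linarith)
  have h7 := half_le_cos_sub (ε := ε) (t := t') hb hε.le (by linarith) (by linarith)
  -- Otherwise the overlap would fall below cos t', which the initial state already guarantees.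
  have h8 : ε / 2 ≤ p.1 := by
    nlinarith [cos_le_one t', mul_le_mul_of_nonneg_left h4 hs,
      mul_le_mul_of_nonneg_right (cos_le_one t') h1]
  have h9 : p.2 ≤ δ := (hK.small p hp).resolve_left (by linarith)
  have hm : ε / 2 ≤ sin ((t' + t) / 2) := by
    linarith [half_le_sin_of_le_pi_sub (x := (t' + t) / 2) (y := ε) hε.le (by linarith)
      (by linarith)]
  have hd : 0 < sin ((t' - t) / 2) :=
    sin_pos_of_pos_of_lt_pi (by linarith) (by linarith [pi_pos])
  have hm' : cos ((t' + t) / 2) * p.2 < sin ((t' + t) / 2) * p.1 := by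
    have e1 : cos ((t' + t) / 2) * p.2 ≤ 1 * p.2 :=
      mul_le_mul_of_nonneg_right (cos_le_one _) h2
    nlinarith
  have e1 := cos_sub_cos t' t
  have e2 := sin_sub_sin t' t
  -- The difference is 2 sin((t' - t)/2)(sin m · p.1 - cos m · p.2), with m the mean angle.
  have h10 : cos t' * p.1 + sin t' * p.2 < cos t * p.1 + sin t * p.2 := by
    have := mul_pos hd (sub_pos.2 hm')
    nlinarith
  have h11 := hE.2 p hp
  have h12 : (cos t' * p.1 + sin t' * p.2) ^ 2 < (cos t * p.1 + sin t * p.2) ^ 2 :=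
    pow_lt_pow_left₀ h10 (by positivity) two_ne_zero
  linarith

/-- Mirror image: the pair optimal at t lies mainly along the marked direction and does strictly
better at t'. The margin to π/2 keeps the cosine of the mean angle at least ε/2. -/
theorem lt_of_turning_lt (hK : IsOverlapRegion K b θ δ) {ε : ℝ} (hε : 0 < ε) (hε1 : ε ≤ 1 / 2)
    (hδ : δ ≤ ε ^ 4 / 1000) {t t' E E' : ℝ} (ht : arctan (1 / b) + ε ≤ t) (htt : t < t')
    (ht' : t' ≤ π / 2 - ε) (hE : IsRegionGme K t E) (hE' : IsRegionGme K t' E') :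
    E' < E := by
  have hb := hK.pos
  have hlt := arctan_inv_pos hb
  have hδε : δ < ε ^ 2 / 8 := by
    have h1 : 0 < ε ^ 2 := by positivity
    have h2 : ε ^ 2 ≤ 1 / 4 := by nlinarith
    nlinarith
  have hδε' : δ < ε / 8 := by nlinarith
  obtain ⟨p, hp, h⟩ := hE.1
  have hs : 0 ≤ sin t := sin_nonneg_of_nonneg_of_le_pi (by linarith) (by linarith [pi_pos])
  have hc : 0 ≤ cos t := cos_nonneg_of_mem_Icc ⟨by linarith [pi_pos], by linarith⟩
  rw [abs_of_nonneg hs, abs_of_nonneg hc] at h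
  have h1 := hK.fst_nonneg p hp
  have h2 := hK.snd_nonneg p hp
  have h3 := hK.fst_le p hp
  have h5 : sin t * b ≤ cos t * p.1 + sin t * p.2 := by
    obtain ⟨r, hr, hrb⟩ := hK.exists_snd_eq
    have h6 := hE.2 _ hr
    rw [hrb] at h6
    have h7 := hK.fst_nonneg r hr
    have h8 := le_of_sq_le_sq (h6.trans h) (by positivity)
    nlinarith
  have h7 := half_le_sin_sub (ε := ε) (t := t) hb hε.le (by linarith) (by linarith)
  have h8 : ε / 2 ≤ p.2 := by
    nlinarith [mul_le_mul_of_nonneg_left h3 hc, mul_le_mul_of_nonneg_right (sin_le_one t) h2]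
  have h9 : p.1 ≤ δ := (hK.small p hp).resolve_right (by linarith)
  have hm : ε / 2 ≤ cos ((t' + t) / 2) := by
    rw [← sin_pi_div_two_sub]
    linarith [half_le_sin_of_le_pi_sub (x := π / 2 - (t' + t) / 2) (y := ε) hε.le (by linarith)
      (by linarith)]
  have hd : 0 < sin ((t' - t) / 2) :=
    sin_pos_of_pos_of_lt_pi (by linarith) (by linarith [pi_pos])
  have hm' : sin ((t' + t) / 2) * p.1 < cos ((t' + t) / 2) * p.2 := by
    have e1 : sin ((t' + t) / 2) * p.1 ≤ 1 * p.1 :=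
      mul_le_mul_of_nonneg_right (sin_le_one _) h1
    nlinarith
  have e1 := cos_sub_cos t' t
  have e2 := sin_sub_sin t' t
  have h10 : cos t * p.1 + sin t * p.2 < cos t' * p.1 + sin t' * p.2 := by
    have := mul_pos hd (sub_pos.2 hm')
    nlinarith
  have h11 := hE'.2 p hp
  have h12 : (cos t * p.1 + sin t * p.2) ^ 2 < (cos t' * p.1 + sin t' * p.2) ^ 2 :=
    pow_lt_pow_left₀ h10 (by positivity) two_ne_zero
  linarith

theorem lt_of_add_le_turning (hK : IsOverlapRegion K b θ δ) {ε : ℝ} (hε : 0 < ε)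
    (hε1 : ε ≤ 1 / 2) (hδ : δ ≤ ε ^ 4 / 1000) {t t' E E' : ℝ} (ht : 0 ≤ t) (htt : t + ε ≤ t')
    (ht' : t' ≤ arctan (1 / b)) (hE : IsRegionGme K t E) (hE' : IsRegionGme K t' E') :
    E < E' := by
  have hε2 : ε ^ 2 ≤ 1 / 4 := by nlinarith
  have hε3 : ε ^ 4 ≤ ε ^ 2 / 4 := by nlinarith [sq_nonneg ε]
  have h1 := hK.abs_sub_sin_sq_le (by linarith) ht (by linarith) hE
  have h2 := hK.abs_sub_sin_sq_le (by linarith) (by linarith) ht' hE'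
  have h3 := sin_sq_add_le hε ht htt (by linarith [arctan_lt_pi_div_two (1 / b)])
  rw [abs_le] at h1 h2
  have : 0 < ε ^ 2 := by positivity
  linarith [h1.2, h2.1]

theorem lt_of_turning_add_le (hK : IsOverlapRegion K b θ δ) {ε : ℝ} (hε : 0 < ε)
    (hε1 : ε ≤ 1 / 2) (hδ : δ ≤ ε ^ 4 / 1000) {t t' E E' : ℝ} (ht : arctan (1 / b) ≤ t)
    (htt : t + ε ≤ t') (ht' : t' ≤ π / 2 + θ) (hE : IsRegionGme K t E)
    (hE' : IsRegionGme K t' E') : E' < E := by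
  have hε2 : ε ^ 2 ≤ 1 / 4 := by nlinarith
  have hε3 : ε ^ 4 ≤ ε ^ 2 / 4 := by nlinarith [sq_nonneg ε]
  have h1 := hK.abs_sub_one_sub_le (by linarith) ht (by linarith) hE
  have h2 := hK.abs_sub_one_sub_le (by linarith) (by linarith) ht' hE'
  have h3 := sin_sq_mul_add_le hK.pos hK.le_one hε hε1
    (by nlinarith [hK.angle_le]) ht htt ht'
  rw [abs_le] at h1 h2
  have : 0 < ε ^ 4 := by positivity
  linarith [h1.1, h2.2]

/-- A state whose entanglement is at least that of a state just below the turning point is itself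
close to the turning point. -/
theorem abs_sub_turning_le (hK : IsOverlapRegion K b θ δ) {ε : ℝ} (hε : 0 < ε)
    (hε1 : ε ≤ 1 / 2) (hδ : δ ≤ ε ^ 4 / 1000) {t t' E E' : ℝ} (ht0 : 0 ≤ t)
    (ht : t ≤ arctan (1 / b)) (htt : arctan (1 / b) ≤ t + 2 * θ) (ht0' : 0 ≤ t')
    (ht' : t' ≤ π / 2 + θ) (hE : IsRegionGme K t E) (hE' : IsRegionGme K t' E')
    (hle : E ≤ E') : |t' - arctan (1 / b)| ≤ ε := by
  have hε2 : ε ^ 2 ≤ 1 / 4 := by nlinarith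
  have hε3 : ε ^ 4 ≤ ε ^ 2 / 4 := by nlinarith [sq_nonneg ε]
  have hε4 : 0 < ε ^ 4 := by positivity
  have h1 := (abs_le.1 (hK.abs_sub_sin_sq_le (by linarith) ht0 ht hE)).1
  have h2 := (abs_le.1 (abs_sin_sq_sub_sin_sq_le t (arctan (1 / b)))).2
  rw [abs_of_nonneg (by linarith)] at h2
  have hθ := hK.angle_le
  have hlt := arctan_lt_pi_div_two (1 / b)
  rw [abs_le]
  constructor
  · by_contra! h
    have h3 := (abs_le.1 (hK.abs_sub_sin_sq_le (by linarith) ht0' (by linarith) hE')).2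
    have h4 := sin_sq_add_le (t' := arctan (1 / b)) hε ht0' (by linarith) hlt.le
    linarith
  · by_contra! h
    have h3 := (abs_le.1 (hK.abs_sub_one_sub_le (by linarith) (by linarith) ht' hE')).2
    have h4 := sin_sq_mul_add_le hK.pos hK.le_one hε hε1
      (by nlinarith) le_rfl (show arctan (1 / b) + ε ≤ t' by linarith) ht'
    -- The two branches agree at the turning point.
    have h5 : sin (arctan (1 / b)) ^ 2 = 1 - sin (arctan (1 / b)) ^ 2 * b ^ 2 := by
      rw [← mul_pow, ← cos_arctan_inv hK.pos]
      linarith [sin_sq_add_cos_sq (arctan (1 / b))]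
    linarith

end IsOverlapRegion


/-! ### The region of a marked set, and iteration counts -/

/-- The overlaps of the real product states with the superpositions of the unmarked and of the
marked basis states. -/
def overlapRegion {n : ℕ} (S : Finset (Fin n → Fin 2)) : Set (ℝ × ℝ) :=
  {p | ∃ a : Fin n → ℝ, (∀ i, a i ∈ Icc 0 (π / 2)) ∧ p = (overlap Sᶜ a, overlap S a)}

theorem baseAngle_pos {n : ℕ} {S : Finset (Fin n → Fin 2)} (hS : S.Nonempty) :
    0 < baseAngle S := by
  have : 0 < (S.card : ℝ) := by exact_mod_cast hS.card_pos
  exact arcsin_pos.2 (sqrt_pos.2 (by positivity))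

theorem baseAngle_le {n : ℕ} {S : Finset (Fin n → Fin 2)} {δ : ℝ} (hδ : 0 ≤ δ)
    (h : (S.card : ℝ) ≤ δ ^ 2 / 4 * 2 ^ n) : baseAngle S ≤ δ := by
  have h1 := half_le_sin (arcsin_nonneg.2 (sqrt_nonneg ((S.card : ℝ) / 2 ^ n)))
    (arcsin_le_pi_div_two _)
  have h2 : sin (baseAngle S) ≤ δ / 2 := by
    rw [sin_baseAngle]
    refine sqrt_le_iff.2 ⟨by positivity, ?_⟩
    rw [div_le_iff₀ (by positivity)]
    linarith
  change baseAngle S / 2 ≤ sin (baseAngle S) at h1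
  linarith

theorem isOverlapRegion {n : ℕ} {S : Finset (Fin n → Fin 2)} (hne : S.Nonempty)
    (hS : IsSymmetricSet S) {δ : ℝ} (hδ : 0 < δ) (hδ1 : δ ≤ 1)
    (h : (S.card : ℝ) ≤ δ ^ 12 / 512 * 2 ^ n) :
    IsOverlapRegion (overlapRegion S) (Bmax n (weights S)) (baseAngle S) δ where
  fst_nonneg := by rintro _ ⟨a, ha, rfl⟩; exact overlap_nonneg _ ha
  fst_le := by rintro _ ⟨a, -, rfl⟩; exact overlap_le_one _ a
  snd_nonneg := by rintro _ ⟨a, ha, rfl⟩; exact overlap_nonneg _ ha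
  snd_le := by rintro _ ⟨a, ha, rfl⟩; exact overlap_le_Bmax hS ha
  small := by rintro _ ⟨a, ha, rfl⟩; exact overlap_compl_le_or_overlap_le S ha hδ hδ1 h
  initial_mem := by
    refine ⟨fun _ => π / 4, fun _ => ⟨by positivity, by linarith [pi_pos]⟩, ?_⟩
    rw [overlap_pi_div_four, overlap_pi_div_four, cos_baseAngle, sin_baseAngle]
  exists_snd_eq := by
    obtain ⟨a, ha, hb⟩ := exists_overlap_eq_Bmax S
    exact ⟨_, ⟨a, ha, rfl⟩, hb⟩
  pos := Bmax_pos hne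
  le_one := Bmax_le_one S
  angle_pos := baseAngle_pos hne
  angle_le := by
    refine baseAngle_le hδ.le (h.trans (mul_le_mul_of_nonneg_right ?_ (by positivity)))
    have h1 : δ ^ 12 ≤ δ ^ 2 := pow_le_pow_of_le_one hδ.le hδ1 (by norm_num)
    have h2 : 0 ≤ δ ^ 2 := by positivity
    linarith

theorem isRegionGme {n : ℕ} {S : Finset (Fin n → Fin 2)} (hS : S.Nonempty) (hS' : Sᶜ.Nonempty)
    (k : ℕ) : IsRegionGme (overlapRegion S) (angle S k) (gme (groverState S k)) := by
  rw [groverState_eq_planeState hS hS']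
  constructor
  · obtain ⟨a, ha, h⟩ := exists_one_sub_gme_le S (angle S k)
    exact ⟨_, ⟨a, ha, rfl⟩, h⟩
  · rintro _ ⟨a, -, rfl⟩
    exact le_one_sub_gme S _ a

theorem compl_nonempty_of_card_le {n : ℕ} {S : Finset (Fin n → Fin 2)} {η : ℝ} (hη : η < 1)
    (h : (S.card : ℝ) ≤ η * 2 ^ n) : Sᶜ.Nonempty := by
  rw [← Finset.card_pos, ← Nat.cast_pos (α := ℝ)]
  have := card_add_card_compl S
  have hp : (0 : ℝ) < 2 ^ n := by positivity
  nlinarith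

section iterations

variable {n : ℕ} {S : Finset (Fin n → Fin 2)}

theorem angle_nonneg (hS : S.Nonempty) (k : ℕ) : 0 ≤ angle S k := by
  have := baseAngle_pos hS
  unfold angle
  positivity

theorem angle_strictMono (hS : S.Nonempty) {k k' : ℕ} (h : k < k') : angle S k < angle S k' := by
  have h1 : (k : ℝ) < k' := by exact_mod_cast h
  exact mul_lt_mul_of_pos_right (by linarith) (baseAngle_pos hS)

/-- The angle of the optimal iteration differs from `π/2` by at most the base angle. -/
theorem abs_kOpt_mul_sub_le (hS : S.Nonempty) :
    |(2 * (kOpt S : ℝ) + 1) * baseAngle S - π / 2| ≤ baseAngle S := by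
  have hθ := baseAngle_pos hS
  have h := abs_sub_round ((π / (2 * baseAngle S) - 1) / 2)
  change |_ - (kOpt S : ℝ)| ≤ 1 / 2 at h
  have e : π / (2 * baseAngle S) * baseAngle S = π / 2 := by field_simp
  rw [abs_le] at h ⊢
  constructor <;> nlinarith [h.1, h.2]

theorem angle_le_of_le_kOpt (hS : S.Nonempty) {k : ℕ} (hk : (k : ℤ) ≤ kOpt S) :
    angle S k ≤ π / 2 + baseAngle S := by
  have h := (abs_le.1 (abs_kOpt_mul_sub_le hS)).2
  have h1 : (k : ℝ) ≤ kOpt S := by exact_mod_cast hk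
  have := baseAngle_pos hS
  unfold angle
  nlinarith

/-- Every angle between the base angle and `π/2` is reached up to two base angles. -/
theorem exists_angle_le (hS : S.Nonempty) {T : ℝ} (hT : baseAngle S ≤ T) (hT' : T < π / 2) :
    ∃ j : ℕ, (j : ℤ) ≤ kOpt S ∧ angle S j ≤ T ∧ T ≤ angle S j + 2 * baseAngle S := by
  have hθ := baseAngle_pos hS
  have h0 : 0 ≤ (T / baseAngle S - 1) / 2 := by
    have := (one_le_div hθ).2 hT
    linarith
  have e : T / baseAngle S * baseAngle S = T := by field_simp
  have h1 := Nat.floor_le h0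
  have h2 := Nat.lt_floor_add_one ((T / baseAngle S - 1) / 2)
  set j := ⌊(T / baseAngle S - 1) / 2⌋₊
  have h3 : angle S j ≤ T := by unfold angle; nlinarith
  refine ⟨j, ?_, h3, by unfold angle; nlinarith⟩
  -- By the rounding bound, the angle of any index beyond `kOpt S` is at least π/2 + θ, which
  -- exceeds T.
  by_contra! h
  have h4 : (kOpt S : ℝ) + 1 ≤ j := by exact_mod_cast h
  have h5 := (abs_le.1 (abs_kOpt_mul_sub_le hS)).1
  unfold angle at h3
  nlinarith

/-- Since θ_T = r·π/2 with 0 ≤ r ≤ 1, the error is a convex combination of the rounding error of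
`kOpt S` and of θ. -/
theorem abs_turningIteration_sub_le (hS : S.Nonempty) :
    |(2 * turningIteration S + 1) * baseAngle S - turningPoint n (weights S)| ≤
      2 * baseAngle S := by
  have hθ := baseAngle_pos hS
  have h := abs_kOpt_mul_sub_le hS
  have h0 : 0 < turningPoint n (weights S) := arctan_inv_pos (Bmax_pos hS)
  have h1 : turningPoint n (weights S) < π / 2 := arctan_lt_pi_div_two _
  set r := 2 / π * turningPoint n (weights S) with hr
  have hr0 : 0 ≤ r := by positivity
  have hr1 : r ≤ 1 := by
    rw [hr, div_mul_eq_mul_div, div_le_one pi_pos]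
    linarith
  have e1 : r * (π / 2) = turningPoint n (weights S) := by rw [hr]; field_simp
  have e2 : (2 * turningIteration S + 1) * baseAngle S - turningPoint n (weights S) =
      r * ((2 * (kOpt S : ℝ) + 1) * baseAngle S - π / 2) + (1 - r) * baseAngle S := by
    rw [turningIteration, ← hr]
    linear_combination e1
  rw [e2]
  rw [abs_le] at h ⊢
  constructor <;> nlinarith [h.1, h.2]

end iterations

theorem strictMonoOn_sin_sq : StrictMonoOn (fun t : ℝ => sin t ^ 2) (Icc 0 (π / 2)) := by
  intro s hs t ht hst
  have h1 := strictMonoOn_sin (a := s) (b := t) ⟨by linarith [hs.1, pi_pos], hs.2⟩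
    ⟨by linarith [ht.1, pi_pos], ht.2⟩ hst
  exact pow_lt_pow_left₀ h1 (sin_nonneg_of_nonneg_of_le_pi hs.1 (by linarith [hs.2, pi_pos]))
    two_ne_zero

end
end Grover

/-! ### Choice of constants and conclusion -/

/-- First part: for every symmetric marked state, the turning point lies strictly between `0` and
`π/2`, it solves `cos θ_T = B_max sin θ_T`, and the two branches of the limiting curve are strictly
increasing on `[0, θ_T]` and strictly decreasing on `[θ_T, π/2]`.
Second part: as `M/N → 0`, uniformly in everything else, the GME along the run of the algorithm
follows these two branches, is itself strictly increasing and then strictly decreasing, and is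
largest at the turning point. -/
theorem lemma2 :
    (∀ (n : ℕ) (S : Finset (Fin n → Fin 2)), S.Nonempty →
      Grover.IsSymmetricState (Grover.uniformSuperposition S) →
        IsGreatest (Grover.B n (Grover.weights S) '' Set.Icc 0 Real.pi)
            (Grover.Bmax n (Grover.weights S)) ∧
        0 < Grover.turningPoint n (Grover.weights S) ∧
        Grover.turningPoint n (Grover.weights S) < Real.pi / 2 ∧
        Real.cos (Grover.turningPoint n (Grover.weights S)) =
          Real.sin (Grover.turningPoint n (Grover.weights S)) *
            Grover.Bmax n (Grover.weights S) ∧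
        StrictMonoOn (fun t : ℝ => Real.sin t ^ 2)
          (Set.Icc 0 (Grover.turningPoint n (Grover.weights S))) ∧
        StrictAntiOn (fun t : ℝ => 1 - Real.sin t ^ 2 * Grover.Bmax n (Grover.weights S) ^ 2)
          (Set.Icc (Grover.turningPoint n (Grover.weights S)) (Real.pi / 2))) ∧
    (∀ ε : ℝ, 0 < ε → ∃ η : ℝ, 0 < η ∧
      ∀ (n : ℕ) (S : Finset (Fin n → Fin 2)), S.Nonempty →
        Grover.IsSymmetricState (Grover.uniformSuperposition S) →
        (S.card : ℝ) ≤ η * 2 ^ n →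
        -- the two branches of the GME
        (∀ k : ℕ, (k : ℤ) ≤ Grover.kOpt S →
          (Grover.angle S k ≤ Grover.turningPoint n (Grover.weights S) →
            |Grover.gme (Grover.groverState S k) - Real.sin (Grover.angle S k) ^ 2| ≤ ε) ∧
          (Grover.turningPoint n (Grover.weights S) < Grover.angle S k →
            |Grover.gme (Grover.groverState S k) -
              (1 - Real.sin (Grover.angle S k) ^ 2 *
                Grover.Bmax n (Grover.weights S) ^ 2)| ≤ ε)) ∧
        -- the GME increases below the turning point
        (∀ k k' : ℕ, k < k' → (k' : ℤ) ≤ Grover.kOpt S →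
          Grover.angle S k' ≤ Grover.turningPoint n (Grover.weights S) →
          (Grover.angle S k + ε ≤ Grover.angle S k' ∨
            (ε ≤ Grover.angle S k ∧
              Grover.angle S k' ≤ Grover.turningPoint n (Grover.weights S) - ε)) →
          Grover.gme (Grover.groverState S k) < Grover.gme (Grover.groverState S k')) ∧
        -- the GME decreases above the turning point
        (∀ k k' : ℕ, k < k' → (k' : ℤ) ≤ Grover.kOpt S →
          Grover.turningPoint n (Grover.weights S) ≤ Grover.angle S k →
          (Grover.angle S k + ε ≤ Grover.angle S k' ∨
            (Grover.turningPoint n (Grover.weights S) + ε ≤ Grover.angle S k ∧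
              Grover.angle S k' ≤ Real.pi / 2 - ε)) →
          Grover.gme (Grover.groverState S k') < Grover.gme (Grover.groverState S k)) ∧
        -- the GME is largest at the turning point
        (∀ k : ℕ, (k : ℤ) ≤ Grover.kOpt S →
          (∀ k' : ℕ, (k' : ℤ) ≤ Grover.kOpt S →
            Grover.gme (Grover.groverState S k') ≤ Grover.gme (Grover.groverState S k)) →
          |Grover.angle S k - Grover.turningPoint n (Grover.weights S)| ≤ ε) ∧
        -- the turning iteration corresponds to the turning point
        |(2 * Grover.turningIteration S + 1) * Grover.baseAngle S -
          Grover.turningPoint n (Grover.weights S)| ≤ ε) := by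
  refine ⟨fun n S hS _ => ?_, fun ε hε => ?_⟩
  · have hb := Grover.Bmax_pos hS
    have h0 : 0 < Grover.turningPoint n (Grover.weights S) := Grover.arctan_inv_pos hb
    have h1 : Grover.turningPoint n (Grover.weights S) < Real.pi / 2 :=
      Real.arctan_lt_pi_div_two _
    refine ⟨Grover.isGreatest_Bmax _, h0, h1, Grover.cos_arctan_inv hb,
      Grover.strictMonoOn_sin_sq.mono (Set.Icc_subset_Icc_right h1.le), ?_⟩
    intro s hs t ht hst
    have h2 := Grover.strictMonoOn_sin_sq (Set.Icc_subset_Icc_left h0.le hs)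
      (Set.Icc_subset_Icc_left h0.le ht) hst
    exact sub_lt_sub_left (mul_lt_mul_of_pos_right h2 (by positivity)) 1
  · obtain ⟨ε', hε', hle, hhalf⟩ : ∃ ε' : ℝ, 0 < ε' ∧ ε' ≤ ε ∧ ε' ≤ 1 / 2 :=
      ⟨min ε (1 / 2), by positivity, min_le_left _ _, min_le_right _ _⟩
    -- Comparing values on the branches loses at most 14δ in all, against a gain of at least ε'⁴/32.
    obtain ⟨δ, hδ⟩ : ∃ δ : ℝ, δ = ε' ^ 4 / 1000 := ⟨_, rfl⟩
    have hδ0 : 0 < δ := by rw [hδ]; positivity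
    have hδε : δ ≤ ε' / 1000 := by
      have := pow_le_of_le_one hε'.le (by linarith : ε' ≤ 1) four_ne_zero
      linarith
    have hδ1 : δ ≤ 1 := by linarith
    have hη : δ ^ 12 / 512 < 1 := by
      have := pow_le_one₀ hδ0.le hδ1 (n := 12)
      linarith
    refine ⟨δ ^ 12 / 512, by positivity, fun n S hS hsym hcard => ?_⟩
    have hK := Grover.isOverlapRegion hS (Grover.isSymmetricSet_of_isSymmetricState hS hsym)
      hδ0 hδ1 hcard
    have hE := Grover.isRegionGme hS (Grover.compl_nonempty_of_card_le hη hcard)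
    have hang := fun k => Grover.angle_nonneg hS k
    have hopt := fun k hk => Grover.angle_le_of_le_kOpt hS (k := k) hk
    have hθ := hK.angle_le
    have hT : Real.pi / 4 ≤ Grover.turningPoint n (Grover.weights S) :=
      Grover.pi_div_four_le_arctan_inv hK.pos hK.le_one
    have hT' : Grover.turningPoint n (Grover.weights S) < Real.pi / 2 :=
      Real.arctan_lt_pi_div_two _
    refine ⟨fun k hk => ⟨fun h => ?_, fun h => ?_⟩, fun k k' hkk hk' h hsep => ?_,
      fun k k' hkk hk' h hsep => ?_, fun k hk hmax => ?_, ?_⟩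
    · have := hK.abs_sub_sin_sq_le hδ1 (hang k) h (hE k)
      linarith
    · have := hK.abs_sub_one_sub_le hδ1 h.le (hopt k hk) (hE k)
      linarith
    · rcases hsep with h1 | ⟨h1, h2⟩
      · exact hK.lt_of_add_le_turning hε' hhalf hδ.le (hang k) (by linarith) h (hE k) (hE k')
      · refine hK.lt_of_lt_turning hε' hhalf hδ.le (by linarith)
          (Grover.angle_strictMono hS hkk) ?_ (hE k) (hE k')
        exact h2.trans (sub_le_sub_left hle _)
    · rcases hsep with h1 | ⟨h1, h2⟩
      · exact hK.lt_of_turning_add_le hε' hhalf hδ.le h (by linarith) (hopt k' hk') (hE k)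
          (hE k')
      · refine hK.lt_of_turning_lt hε' hhalf hδ.le ?_
          (Grover.angle_strictMono hS hkk) (by linarith) (hE k) (hE k')
        exact (add_le_add_right hle _).trans h1
    · obtain ⟨j, hj, hj1, hj2⟩ := Grover.exists_angle_le hS
        (T := Grover.turningPoint n (Grover.weights S))
        (by linarith [Real.pi_gt_three]) hT'
      exact (hK.abs_sub_turning_le hε' hhalf hδ.le (hang j) hj1 hj2 (hang k) (hopt k hk) (hE j)
        (hE k) (hmax j hj)).trans hle
    · have := Grover.abs_turningIteration_sub_le hS
      linarith
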